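/- All graphs are finite and simple. For a graph $G$ let $L(G)$ be its line graph, and put $L^1(G)=L(G)$, $L^{n}(G)=L(L^{n-1}(G))$ for $n\ge 2$. For $i\ge 1$, $L^{-i}(G)$ denotes a connected graph $K$ with $L^i(K)\cong G$, if there is one (when $G$ is connected and $G\not\cong K_3$, such a $K$ is unique up to isomorphism, by Whitney's theorem). A graph is claw-free if it has no induced $K_{1,3}$. Let $G_1=K_{1,3}$; let $G_2$ be $K_4-e$ together with a new vertex adjacent to exactly the two vertices of degree $2$ of $K_4-e$; $G_3=K_5-e$; $G_4$ is $K_4-e$ with a pendant edge attached at each of its two vertices of degree $2$; $G_5$ is a triangle and a $K_4$ sharing exactly one edge, with a pendant edge attached at the vertex of the triangle outside the $K_4$; $G_6$ is two copies of $K_4$ sharing exactly one edge; $G_7$ is $G_4$ with an edge added between its two vertices of degree $1$; $G_8=P_6^2$ is the square of the path on the six vertices $0,1,2,3,4,5$ (in this order); $G_9=W_5$ is the wheel with five spokes. Let $H_1=P_7^2$ be the square of the path on seven vertices; $H_2$ is $G_8$ together with a vertex $6$ adjacent to exactly $0,2,4$; and $H_3$ is $G_8$ together with a vertex $6$ adjacent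 to $0,1$ and a vertex $7$ adjacent to $1,3,5,6$. (Thus $G_1,\dots,G_9$ are Beineke's nine minimal forbidden induced subgraphs for line graphs, and $G_8,G_9,H_1,H_2,H_3$ are, up to isomorphism, the connected graphs that are not line graphs and contain none of $G_1,\dots,G_7$ as an induced subgraph.) Let $F_1=L(G_4)$ and $F_2=L(G_2)$. **Theorem.** Let $G$ be a connected graph not isomorphic to any of $K_3$, $G_8$, $G_9$, $H_1$, $H_2$, $H_3$, and let $n\ge 2$ be an integer. Suppose that (a) for every $i\in\{1,\dots,n-1\}$, $L^{-i}(G)$, if it exists, is claw-free (that is, every connected graph $K$ with $L^i(K)\cong G$ is claw-free); (b) $G$ contains none of $G_1,\dots,G_7$, $F_1$, $F_2$ as an induced subgraph. Then there is a connected graph $H$ with $G\cong L^n(H)$. -/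

import Mathlib

open scoped SimpleGraph

namespace HigherLine

/-- The simple graph on the vertices `0, …, n - 1` whose edges are the listed pairs. -/
def ofEdges (n : ℕ) (l : List (Fin n × Fin n)) : SimpleGraph (Fin n) :=
  SimpleGraph.fromRel fun i j => (i, j) ∈ l

instance (n : ℕ) (l : List (Fin n × Fin n)) : DecidableRel (ofEdges n l).Adj :=
  inferInstanceAs (DecidableRel (SimpleGraph.fromRel fun i j => (i, j) ∈ l).Adj)

/-! The nine graphs of Beineke. In `G2`, …, `G7` the vertices `0, 1, 2, 3` carry two triangles
`0 1 2` and `1 2 3` with the common edge `1 2`, where `0` and `3` are not adjacent. -/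

/-- The claw `K_{1,3}`. -/
abbrev G1 : SimpleGraph (Fin 4) := ofEdges 4 [(0, 1), (0, 2), (0, 3)]

/-- `K_4 - e` and a vertex adjacent to its two vertices of degree two. -/
abbrev G2 : SimpleGraph (Fin 5) :=
  ofEdges 5 [(0, 1), (0, 2), (1, 2), (1, 3), (2, 3), (0, 4), (3, 4)]

/-- `K_5 - e`. -/
abbrev G3 : SimpleGraph (Fin 5) :=
  ofEdges 5 [(0, 1), (0, 2), (1, 2), (1, 3), (2, 3), (0, 4), (1, 4), (2, 4), (3, 4)]

/-- `K_4 - e` with one pendant edge at each of its two vertices of degree two. -/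
abbrev G4 : SimpleGraph (Fin 6) :=
  ofEdges 6 [(0, 1), (0, 2), (1, 2), (1, 3), (2, 3), (0, 4), (3, 5)]

/-- The triangle `0 1 2` and the clique `1 2 3 5` share the edge `1 2`, and there is a pendant
edge at `0`. -/
abbrev G5 : SimpleGraph (Fin 6) :=
  ofEdges 6 [(0, 1), (0, 2), (1, 2), (1, 3), (2, 3), (0, 4), (1, 5), (2, 5), (3, 5)]

/-- Two copies of `K_4` with one common edge. -/
abbrev G6 : SimpleGraph (Fin 6) :=
  ofEdges 6 [(0, 1), (0, 2), (1, 2), (1, 3), (2, 3), (0, 4), (1, 4), (2, 4), (1, 5), (2, 5), (3, 5)]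

/-- `G4` with an edge added between its two vertices of degree one. -/
abbrev G7 : SimpleGraph (Fin 6) :=
  ofEdges 6 [(0, 1), (0, 2), (1, 2), (1, 3), (2, 3), (0, 4), (3, 5), (4, 5)]

/-- The square of the path on six vertices. -/
abbrev G8 : SimpleGraph (Fin 6) :=
  ofEdges 6 [(0, 1), (1, 2), (2, 3), (3, 4), (4, 5), (0, 2), (1, 3), (2, 4), (3, 5)]

/-- The wheel `W_5`: the hub `0` and the rim cycle `1 2 3 4 5`. -/
abbrev G9 : SimpleGraph (Fin 6) :=
  ofEdges 6 [(0, 1), (0, 2), (0, 3), (0, 4), (0, 5), (1, 2), (2, 3), (3, 4), (4, 5), (5, 1)]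

/-! The graphs of Šoltés: the connected graphs other than `G8`, `G9` that are not line graphs and
have none of `G1`, …, `G7` as an induced subgraph. -/

/-- The square of the path on seven vertices. -/
abbrev H1 : SimpleGraph (Fin 7) :=
  ofEdges 7 [(0, 1), (1, 2), (2, 3), (3, 4), (4, 5), (5, 6),
    (0, 2), (1, 3), (2, 4), (3, 5), (4, 6)]

/-- `G8` and a vertex `6` adjacent to `0, 2, 4`. -/
abbrev H2 : SimpleGraph (Fin 7) :=
  ofEdges 7 [(0, 1), (1, 2), (2, 3), (3, 4), (4, 5), (0, 2), (1, 3), (2, 4), (3, 5),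
    (0, 6), (2, 6), (4, 6)]

/-- `G8`, a vertex `6` adjacent to `0, 1`, and a vertex `7` adjacent to `1, 3, 5, 6`. -/
abbrev H3 : SimpleGraph (Fin 8) :=
  ofEdges 8 [(0, 1), (1, 2), (2, 3), (3, 4), (4, 5), (0, 2), (1, 3), (2, 4), (3, 5),
    (0, 6), (1, 6), (1, 7), (3, 7), (5, 7), (6, 7)]

/-- `F_1 = L(G_4)`. -/
abbrev F1 : SimpleGraph G4.edgeSet := G4.lineGraph

/-- `F_2 = L(G_2)`. -/
abbrev F2 : SimpleGraph G2.edgeSet := G2.lineGraph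

universe u

/-- The iterated line graph `L^n(G)`, with its vertex type:
`L^0(G) = G` and `L^{n+1}(G) = L(L^n(G))`. -/
def iterLineAux {V : Type u} (G : SimpleGraph V) : ℕ → (W : Type u) × SimpleGraph W
  | 0 => ⟨V, G⟩
  | n + 1 => ⟨(iterLineAux G n).2.edgeSet, (iterLineAux G n).2.lineGraph⟩

/-- The iterated line graph `L^n(G)`. -/
def iterLine {V : Type u} (G : SimpleGraph V) (n : ℕ) : SimpleGraph (iterLineAux G n).1 :=
  (iterLineAux G n).2

/-- `K` is a connected graph with `L^i(K) ≅ G`, that is, `K = L^{-i}(G)`. -/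
def IsPreimage {V W : Type*} (i : ℕ) (G : SimpleGraph V) (K : SimpleGraph W) : Prop :=
  K.Connected ∧ Nonempty (G ≃g iterLine K i)

end HigherLine

namespace HigherLine

/-! Take line-graph roots of `G` one at a time. Each root must again be a line graph, and the
invariant that ensures this is `HasNoG2G4`: no copy of `G2` or `G4`, induced or not. A copy of `A`
in `H` makes `L(A)` induced in `L(H)`, so excluding `F1` and `F2` gives the invariant for the first
root. It passes to later roots because `F1` and `F2` both contain `G4`. Each of `G3`, …, `G7` and
the five exceptions contains `G2` or `G4`, so a root with the invariant lacks only claw-freeness,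
which is hypothesis (a).

Each single step is Šoltés' theorem, `exists_lineGraph_iso`. One-vertex extensions, checked by
computation, show that a connected graph without `G1`, …, `G7` that contains `G8` or `G9` is an
exception (`BeinekeFree.not_hasCode_G8_G9`). Otherwise no two odd triangles share an edge with
nonadjacent tips (`BeinekeFree.noOddDiamond`), and the argument of van Rooij and Wilf applies. If
two even triangles share an edge, the graph embeds in `L(K_4)`. If not, the odd triangles generate
cliques that cover every edge, at most two through each vertex, and these cliques are the vertices
of the root. -/

/-! ### Induced subgraphs coded by integers -/

/-- The bit of `N` that records the pair of `i` and `j`. -/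
def pairBit (N i j : ℕ) : Bool :=
  N.testBit (if i < j then j * (j - 1) / 2 + i else i * (i - 1) / 2 + j)

/-- The vertices `φ 0, …, φ (n - 1)` are distinct and induce the graph coded by the bits of `N`. -/
def IsCode {V : Type*} (G : SimpleGraph V) (n N : ℕ) (φ : ℕ → V) : Prop :=
  ∀ i j, i < j → j < n → φ i ≠ φ j ∧ (G.Adj (φ i) (φ j) ↔ pairBit N i j = true)

/-- `G` has an induced subgraph coded by `n` and `N`. -/
def HasCode {V : Type*} (G : SimpleGraph V) (n N : ℕ) : Prop :=
  ∃ φ : ℕ → V, IsCode G n N φ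

theorem pairBit_comm (N i j : ℕ) : pairBit N i j = pairBit N j i := by
  unfold pairBit
  rcases lt_trichotomy i j with h | rfl | h
  · simp [h, h.not_gt]
  · rfl
  · simp [h, h.not_gt]

/-- The indices in `e` embed the graph coded by `k` and `P` into the one coded by `n` and `N`. -/
def embCheck (k P n N : ℕ) (e : List ℕ) : Bool :=
  (List.range k).all fun j => (List.range j).all fun i =>
    (e.getD i 0 != e.getD j 0) && (decide (e.getD i 0 < n) && (decide (e.getD j 0 < n) &&
      (pairBit P i j == pairBit N (e.getD i 0) (e.getD j 0))))

variable {V : Type*} {G : SimpleGraph V} {n N k P : ℕ} {φ : ℕ → V}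

theorem IsCode.hasCode_of_embCheck (h : IsCode G n N φ) {e : List ℕ}
    (he : embCheck k P n N e = true) : HasCode G k P := by
  refine ⟨fun i => φ (e.getD i 0), fun i j hij hj => ?_⟩
  simp only [embCheck, List.all_eq_true, List.mem_range, Bool.and_eq_true, bne_iff_ne, ne_eq,
    decide_eq_true_eq, beq_iff_eq] at he
  obtain ⟨hne, hi', hj', hb⟩ := he j hj i hij
  dsimp only
  generalize e.getD i 0 = a at *
  generalize e.getD j 0 = b at *
  rw [hb]
  rcases lt_or_gt_of_ne hne with hab | hab
  · exact h a b hab hj'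
  · rw [pairBit_comm, G.adj_comm]
    exact ⟨(h b a hab hi').1.symm, (h b a hab hi').2⟩

/-- Adding a vertex to a coded graph, adjacent to the vertices at the bits of `m`. -/
def extCode (n N m : ℕ) : ℕ := 2 ^ (n * (n - 1) / 2) * m + N

/-- Pairs are ordered by their larger index, so the pairs with the new vertex `n` occupy the bits
from `n * (n - 1) / 2` on, just above those of `N`. -/
theorem IsCode.extend (h : IsCode G n N φ) (hN : N < 2 ^ (n * (n - 1) / 2)) {v : V} {m : ℕ}
    (hv : ∀ i < n, φ i ≠ v) (hm : ∀ i < n, (G.Adj (φ i) v ↔ m.testBit i = true)) :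
    IsCode G (n + 1) (extCode n N m) (Function.update φ n v) := by
  intro i j hij hj
  rw [Function.update_of_ne (by omega : i ≠ n)]
  rcases (Nat.lt_succ_iff.mp hj).lt_or_eq with hjn | rfl
  · have h1 : j * (j - 1) / 2 + i < n * (n - 1) / 2 := by
      have h2 := Nat.triangle_succ j
      have h3 : (j + 1) * (j + 1 - 1) / 2 ≤ n * (n - 1) / 2 :=
        Nat.div_le_div_right (Nat.mul_le_mul hjn (by omega))
      omega
    rw [Function.update_of_ne hjn.ne]
    have := h i j hij hjn
    simp only [pairBit, hij, if_true] at this ⊢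
    rw [extCode, Nat.testBit_two_pow_mul_add _ hN, if_pos h1]
    exact this
  · simp only [Function.update_self, pairBit, hij, if_true]
    rw [extCode, Nat.testBit_two_pow_mul_add _ hN, if_neg (by omega), Nat.add_sub_cancel_left]
    exact ⟨hv i hij, hm i hij⟩

theorem exists_mask (n : ℕ) (p : ℕ → Prop) :
    ∃ m < 2 ^ n, ∀ i < n, (p i ↔ m.testBit i = true) := by
  classical
  refine ⟨Nat.ofBits fun i : Fin n => decide (p i), Nat.ofBits_lt_two_pow _, fun i hi => ?_⟩
  rw [Nat.testBit_ofBits_lt _ _ hi]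
  simp

theorem isIndContained_of_hasCode {Q : SimpleGraph (Fin n)} (h : HasCode G n N)
    (hQ : ∀ i j : Fin n, i < j → (Q.Adj i j ↔ pairBit N i j = true)) : Q ⊴ G := by
  obtain ⟨φ, h⟩ := h
  refine ⟨⟨⟨fun i => φ i, fun i j hij => ?_⟩, fun {i j} => ?_⟩⟩
  · by_contra hne
    rcases lt_or_gt_of_ne hne with hlt | hlt
    · exact (h i j hlt j.2).1 hij
    · exact (h j i hlt i.2).1 hij.symm
  · change G.Adj (φ i) (φ j) ↔ _
    rcases lt_trichotomy i j with hlt | rfl | hlt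
    · rw [(h i j hlt j.2).2, hQ i j hlt]
    · simp
    · rw [G.adj_comm, Q.adj_comm, (h j i hlt i.2).2, hQ j i hlt]

theorem isCode_of_embedding [Nonempty V] {Q : SimpleGraph (Fin n)} (f : Q ↪g G)
    (hQ : ∀ i j : Fin n, i < j → (Q.Adj i j ↔ pairBit N i j = true)) :
    IsCode G n N fun i => if h : i < n then f ⟨i, h⟩ else Classical.arbitrary V := by
  intro i j hij hj
  have hi := hij.trans hj
  simp only [hi, hj, dif_pos]
  refine ⟨fun h => hij.ne (by simpa using f.injective h), ?_⟩
  rw [f.map_adj_iff, hQ _ _ (by simpa using hij)]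

/-! ### Certificates for one-vertex extensions -/

/-- A certificate: coded graphs, each with a list of candidate embeddings. -/
abbrev Cert := List (ℕ × ℕ × List (List ℕ))

/-- Some entry of the certificate embeds into the graph coded by `n` and `N`. -/
def Cert.covers (c : Cert) (n N : ℕ) : Bool :=
  c.any fun p => p.2.2.any fun e => embCheck p.1 p.2.1 n N e

theorem IsCode.exists_of_covers (h : IsCode G n N φ) {c : Cert} (hc : c.covers n N = true) :
    ∃ p ∈ c, HasCode G p.1 p.2.1 := by
  simp only [Cert.covers, List.any_eq_true] at hc
  obtain ⟨p, hp, e, -, he⟩ := hc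
  exact ⟨p, hp, h.hasCode_of_embCheck he⟩

/-- The certificate covers every extension of a coded graph by a vertex with a neighbour. -/
def Cert.coversExt (c : Cert) (n N : ℕ) : Bool :=
  (List.range (2 ^ n)).all fun m => m == 0 || c.covers (n + 1) (extCode n N m)

/-- If the copy of `Q` is not all of `G`, connectedness yields an outside vertex with a neighbour in
it. The copy with this vertex is an extension by a nonzero mask, so it contains a forbidden graph.
-/
theorem nonempty_iso_of_coversExt (hG : G.Connected) {Q : SimpleGraph (Fin n)} (hn : 0 < n)
    (hQ : ∀ i j : Fin n, i < j → (Q.Adj i j ↔ pairBit N i j = true))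
    (hN : N < 2 ^ (n * (n - 1) / 2)) {c : Cert} (hc : c.coversExt n N = true)
    (hfree : ∀ p ∈ c, ¬ HasCode G p.1 p.2.1) (h : Q ⊴ G) : Nonempty (G ≃g Q) := by
  obtain ⟨f⟩ := h
  by_cases hs : Function.Surjective f
  · exact ⟨(RelIso.ofSurjective f hs).symm⟩
  exfalso
  simp only [Function.Surjective, not_forall] at hs
  obtain ⟨w, hw⟩ := hs
  have hne : Nonempty V := ⟨w⟩
  obtain ⟨p⟩ := hG.preconnected (f ⟨0, hn⟩) w
  obtain ⟨d, -, ⟨i, hi⟩, hv⟩ := p.exists_boundary_dart (Set.range f) ⟨_, rfl⟩ hw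
  set v := d.snd
  have hadj : G.Adj (f i) v := hi ▸ d.adj
  have hcode := isCode_of_embedding f hQ
  set φ : ℕ → V := fun i => if h : i < n then f ⟨i, h⟩ else Classical.arbitrary V
  obtain ⟨m, hm, hbit⟩ := exists_mask n fun i => G.Adj (φ i) v
  have hφ : ∀ j (hj : j < n), φ j = f ⟨j, hj⟩ := fun j hj => by simp [φ, hj]
  have hm0 : m ≠ 0 := by
    rintro rfl
    have := (hbit i i.2).1 (by rw [hφ i i.2]; exact hadj)
    simp at this
  have hext := hcode.extend hN (v := v) (fun j hj h => hv ⟨⟨j, hj⟩, by rw [← h, hφ j hj]⟩) hbit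
  simp only [Cert.coversExt, List.all_eq_true, List.mem_range, Bool.or_eq_true, beq_iff_eq] at hc
  obtain ⟨p, hp, hp'⟩ := hext.exists_of_covers ((hc m hm).resolve_left hm0)
  exact hfree p hp hp'

/-- Certificate for the extensions of `G8` by one vertex. -/
def certG8 : Cert :=
  [(4, 11, [[1, 0, 3, 6], [2, 1, 4, 6], [3, 2, 5, 6], [4, 2, 5, 6], [2, 0, 3, 6], [2, 0, 4, 6],
    [3, 1, 4, 6], [3, 1, 5, 6]]),
   (5, 631, [[2, 0, 1, 6, 4], [3, 1, 2, 6, 5], [0, 1, 2, 3, 6]]),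
   (5, 1015, [[0, 1, 2, 3, 6], [2, 3, 4, 5, 6], [1, 2, 3, 4, 6]]),
   (6, 8311, [[0, 1, 2, 3, 6, 5], [2, 3, 4, 5, 0, 6]]),
   (6, 14455, [[3, 1, 2, 0, 5, 6], [2, 3, 4, 5, 0, 6]]),
   (6, 24695, [[0, 1, 2, 3, 6, 5], [2, 0, 1, 6, 4, 5], [3, 4, 5, 6, 1, 0]]),
   (7, 1598263, [[5, 4, 3, 2, 1, 0, 6], [0, 1, 2, 3, 4, 5, 6]]),
   (7, 713527, [[0, 1, 2, 3, 4, 5, 6], [5, 4, 3, 2, 1, 0, 6]])]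

/-- Certificate for the extensions of `G9` by one vertex. -/
def certG9 : Cert :=
  [(4, 11, [[0, 1, 3, 6], [1, 2, 5, 6], [3, 2, 4, 6], [2, 1, 3, 6], [5, 1, 4, 6], [0, 3, 5, 6],
    [0, 1, 4, 6], [0, 2, 4, 6], [0, 2, 5, 6], [4, 3, 5, 6]]),
   (5, 631, [[0, 1, 2, 6, 4], [0, 1, 5, 6, 3], [2, 0, 1, 5, 6]]),
   (5, 1015, [[1, 0, 2, 3, 6], [1, 0, 5, 4, 6], [2, 0, 3, 4, 6]]),
   (6, 24695, [[2, 1, 6, 5, 3, 4], [3, 4, 6, 5, 2, 1], [1, 2, 6, 3, 5, 4], [2, 3, 6, 4, 1, 5],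
    [1, 5, 6, 4, 2, 3]]),
   (7, 713527, [[4, 3, 0, 2, 1, 6, 5], [5, 1, 0, 2, 3, 6, 4], [1, 2, 0, 3, 4, 6, 5],
    [3, 2, 0, 1, 5, 6, 4], [2, 1, 0, 5, 4, 6, 3]])]

/-- Certificate for the extensions of `H1` by one vertex. -/
def certH1 : Cert :=
  [(4, 11, [[1, 0, 3, 7], [2, 1, 4, 7], [3, 2, 5, 7], [4, 3, 6, 7], [7, 0, 3, 6], [2, 0, 4, 7],
    [4, 2, 6, 7], [5, 3, 6, 7], [3, 1, 4, 7], [3, 1, 5, 7], [4, 2, 5, 7], [2, 0, 3, 7]]),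
   (5, 631, [[3, 1, 2, 7, 5], [1, 2, 3, 4, 7]]),
   (5, 1015, [[1, 2, 3, 4, 7], [2, 3, 4, 5, 7], [0, 1, 2, 3, 7], [3, 4, 5, 6, 7]]),
   (6, 8311, [[0, 1, 2, 3, 7, 5], [1, 2, 3, 4, 7, 6], [2, 3, 4, 5, 0, 7], [1, 3, 7, 5, 0, 6],
    [3, 4, 5, 6, 1, 7]]),
   (6, 14455, [[3, 4, 5, 6, 1, 7], [3, 1, 2, 0, 5, 7]]),
   (6, 24695, [[2, 3, 4, 5, 0, 7], [2, 0, 1, 7, 4, 5], [1, 2, 3, 4, 7, 6], [4, 5, 6, 7, 2, 1]]),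
   (8, 222421815, [[0, 2, 7, 4, 6, 5, 1, 3]])]

/-- Certificate for the extensions of `H2` by one vertex. -/
def certH2 : Cert :=
  [(4, 11, [[0, 1, 6, 7], [1, 0, 3, 7], [3, 2, 5, 7], [2, 0, 4, 7], [7, 1, 5, 6], [4, 3, 6, 7],
    [3, 1, 4, 7], [4, 2, 5, 7], [2, 0, 3, 7], [2, 1, 4, 7], [2, 1, 6, 7], [2, 3, 6, 7], [6, 0,
    4, 7]]),
   (5, 631, [[2, 3, 4, 7, 0]]),
   (5, 1015, [[0, 1, 2, 3, 7], [0, 2, 6, 4, 7], [1, 2, 3, 4, 7], [3, 2, 4, 6, 7]]),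
   (6, 8311, [[0, 1, 2, 3, 7, 5], [0, 2, 6, 4, 7, 5], [2, 3, 4, 5, 0, 7]]),
   (6, 14455, [[2, 3, 4, 5, 0, 7]]),
   (6, 24695, [[0, 1, 2, 3, 7, 5], [0, 2, 6, 4, 7, 5], [1, 0, 7, 6, 3, 4]]),
   (8, 222421815, [[0, 2, 1, 3, 7, 5, 6, 4], [0, 2, 6, 4, 7, 5, 1, 3]])]

/-- Certificate for the extensions of `H3` by one vertex. -/
def certH3 : Cert :=
  [(4, 11, [[0, 2, 6, 8], [1, 0, 3, 8], [2, 1, 4, 8], [3, 2, 5, 8], [8, 0, 4, 7], [5, 4, 7, 8],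
    [8, 2, 5, 6], [6, 0, 7, 8], [7, 1, 5, 8], [1, 2, 7, 8], [7, 3, 6, 8], [1, 0, 7, 8], [3, 1,
    4, 8], [1, 3, 6, 8]]),
   (5, 631, [[3, 1, 7, 6, 8]]),
   (5, 1015, [[2, 1, 3, 7, 8], [0, 1, 2, 3, 8]]),
   (6, 8311, [[4, 3, 5, 7, 8, 6], [1, 3, 7, 5, 0, 8], [0, 1, 2, 3, 8, 5], [2, 3, 4, 5, 0, 8]]),
   (6, 14455, [[3, 1, 2, 0, 5, 8], [2, 3, 4, 5, 0, 8], [1, 2, 3, 4, 6, 8]]),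
   (6, 24695, [[1, 7, 8, 5, 2, 4], [1, 2, 3, 4, 6, 8], [0, 6, 8, 7, 2, 3], [0, 1, 6, 7, 8, 5],
    [2, 0, 8, 6, 3, 7]])]

/-- Certificate for a diamond and a vertex that is odd for both of its triangles. -/
def certOneOdd : Cert :=
  [(4, 11, [[1, 0, 3, 4], [2, 0, 3, 4]]),
   (5, 631, [[0, 1, 2, 3, 4]]),
   (5, 1015, [[0, 1, 2, 3, 4]])]

/-- Certificate for a diamond and two vertices, each odd for one of its triangles. -/
def certTwoOdd : Cert :=
  [(4, 11, [[1, 0, 3, 5], [2, 0, 3, 5], [1, 0, 3, 4], [2, 0, 3, 4], [0, 2, 4, 5], [0, 1, 4, 5],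
    [1, 0, 4, 5], [1, 2, 4, 5], [1, 3, 4, 5], [2, 0, 4, 5], [2, 1, 4, 5], [2, 3, 4, 5], [3, 1,
    4, 5], [3, 2, 4, 5]]),
   (5, 631, [[0, 1, 2, 3, 5], [0, 1, 2, 3, 4], [0, 1, 2, 5, 4], [1, 0, 2, 5, 4], [2, 0, 1, 5,
    4], [3, 1, 2, 4, 5]]),
   (5, 1015, [[0, 1, 2, 3, 5], [0, 1, 2, 3, 4], [2, 0, 1, 5, 4], [1, 0, 2, 5, 4], [0, 1, 2, 5,
    4], [2, 1, 3, 4, 5], [1, 2, 3, 4, 5]]),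
   (6, 8311, [[0, 1, 2, 3, 4, 5]]),
   (6, 14455, [[0, 1, 2, 3, 4, 5], [3, 1, 2, 0, 5, 4]]),
   (6, 14839, [[0, 1, 2, 3, 4, 5]]),
   (6, 24695, [[0, 1, 2, 3, 4, 5]]),
   (6, 25399, [[3, 2, 1, 0, 5, 4], [3, 1, 2, 0, 5, 4], [4, 3, 1, 2, 0, 5], [0, 2, 1, 3, 4, 5],
    [4, 3, 2, 1, 0, 5], [0, 1, 2, 3, 4, 5]]),
   (6, 20079, [[1, 0, 2, 3, 4, 5], [2, 0, 1, 3, 4, 5]])]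

/-! ### The five exceptional graphs -/

/-- No induced subgraph of `G` is one of `G1`, …, `G7`. -/
structure BeinekeFree {V : Type*} (G : SimpleGraph V) : Prop where
  g1 : ¬ G1 ⊴ G
  g2 : ¬ G2 ⊴ G
  g3 : ¬ G3 ⊴ G
  g4 : ¬ G4 ⊴ G
  g5 : ¬ G5 ⊴ G
  g6 : ¬ G6 ⊴ G
  g7 : ¬ G7 ⊴ G

/-- `G` is isomorphic to none of `G8`, `G9`, `H1`, `H2`, `H3`. -/
structure NotExceptional {V : Type*} (G : SimpleGraph V) : Prop where
  g8 : ¬ Nonempty (G ≃g G8)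
  g9 : ¬ Nonempty (G ≃g G9)
  h1 : ¬ Nonempty (G ≃g H1)
  h2 : ¬ Nonempty (G ≃g H2)
  h3 : ¬ Nonempty (G ≃g H3)

theorem G1_isIndContained (h : HasCode G 4 11) : G1 ⊴ G :=
  isIndContained_of_hasCode h (by decide)

theorem G2_isIndContained (h : HasCode G 5 631) : G2 ⊴ G :=
  isIndContained_of_hasCode h (by decide)

theorem G3_isIndContained (h : HasCode G 5 1015) : G3 ⊴ G :=
  isIndContained_of_hasCode h (by decide)

theorem G4_isIndContained (h : HasCode G 6 8311) : G4 ⊴ G :=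
  isIndContained_of_hasCode h (by decide)

theorem G5_isIndContained (h : HasCode G 6 14455) : G5 ⊴ G :=
  isIndContained_of_hasCode h (by decide)

theorem G6_isIndContained (h : HasCode G 6 14839) : G6 ⊴ G :=
  isIndContained_of_hasCode h (by decide)

theorem G7_isIndContained (h : HasCode G 6 24695) : G7 ⊴ G :=
  isIndContained_of_hasCode h (by decide)

theorem G8_adj_iff : ∀ i j : Fin 6, i < j → (G8.Adj i j ↔ pairBit 25399 i j = true) := by
  decide

theorem G9_adj_iff : ∀ i j : Fin 6, i < j → (G9.Adj i j ↔ pairBit 20079 i j = true) := by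
  decide

theorem H1_adj_iff : ∀ i j : Fin 7, i < j → (H1.Adj i j ↔ pairBit 1598263 i j = true) := by
  decide +kernel

theorem H2_adj_iff : ∀ i j : Fin 7, i < j → (H2.Adj i j ↔ pairBit 713527 i j = true) := by
  decide +kernel

theorem H3_adj_iff : ∀ i j : Fin 8, i < j → (H3.Adj i j ↔ pairBit 222421815 i j = true) := by
  decide +kernel

/-- The codes of `G1`, …, `G7`. -/
def beinekeCodes : List (ℕ × ℕ) :=
  [(4, 11), (5, 631), (5, 1015), (6, 8311), (6, 14455), (6, 14839), (6, 24695)]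

theorem BeinekeFree.not_hasCode (h : BeinekeFree G) {p : ℕ × ℕ} (hp : p ∈ beinekeCodes) :
    ¬ HasCode G p.1 p.2 := by
  simp only [beinekeCodes, List.mem_cons, List.not_mem_nil, or_false] at hp
  rcases hp with rfl | rfl | rfl | rfl | rfl | rfl | rfl
  exacts [fun H => h.g1 (G1_isIndContained H), fun H => h.g2 (G2_isIndContained H),
    fun H => h.g3 (G3_isIndContained H), fun H => h.g4 (G4_isIndContained H),
    fun H => h.g5 (G5_isIndContained H), fun H => h.g6 (G6_isIndContained H),
    fun H => h.g7 (G7_isIndContained H)]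

theorem BeinekeFree.not_hasCode_of_cert (h : BeinekeFree G) {c : Cert} (l : List (ℕ × ℕ))
    (hl : ∀ p ∈ l, ¬ HasCode G p.1 p.2)
    (hc : c.all (fun p => (beinekeCodes ++ l).contains (p.1, p.2.1)) = true) :
    ∀ p ∈ c, ¬ HasCode G p.1 p.2.1 := by
  intro p hp
  have := List.all_eq_true.1 hc p hp
  rw [List.contains_iff_mem, List.mem_append] at this
  exact this.elim (fun H => h.not_hasCode H) (hl _)

/-- **Šoltés.** A connected graph without `G1`, …, `G7` that contains `G8` or `G9` is one of five
exceptions. -/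
theorem BeinekeFree.not_hasCode_G8_G9 (h : BeinekeFree G) (hG : G.Connected)
    (hx : NotExceptional G) : ¬ HasCode G 6 25399 ∧ ¬ HasCode G 6 20079 := by
  -- The largest graph comes first: every proper extension of `H3` contains one of `G1`, …, `G7`.
  -- The certificates of `H1` and `H2` may then cite `H3`, that of `G9` cites `H2`, and that of `G8`
  -- cites `H1` and `H2`.
  have h3 : ¬ HasCode G 8 222421815 := fun H => hx.h3 <|
    nonempty_iso_of_coversExt (c := certH3) hG (by norm_num) H3_adj_iff (by norm_num)
      (by decide +kernel) (h.not_hasCode_of_cert [] (by simp) (by decide +kernel))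
      (isIndContained_of_hasCode H H3_adj_iff)
  have h2 : ¬ HasCode G 7 713527 := fun H => hx.h2 <|
    nonempty_iso_of_coversExt (c := certH2) hG (by norm_num) H2_adj_iff (by norm_num)
      (by decide +kernel)
      (h.not_hasCode_of_cert [(8, 222421815)] (by simpa using h3) (by decide +kernel))
      (isIndContained_of_hasCode H H2_adj_iff)
  have h1 : ¬ HasCode G 7 1598263 := fun H => hx.h1 <|
    nonempty_iso_of_coversExt (c := certH1) hG (by norm_num) H1_adj_iff (by norm_num)
      (by decide +kernel)
      (h.not_hasCode_of_cert [(8, 222421815)] (by simpa using h3) (by decide +kernel))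
      (isIndContained_of_hasCode H H1_adj_iff)
  have h9 : ¬ HasCode G 6 20079 := fun H => hx.g9 <|
    nonempty_iso_of_coversExt (c := certG9) hG (by norm_num) G9_adj_iff (by norm_num)
      (by decide +kernel)
      (h.not_hasCode_of_cert [(7, 713527)] (by simpa using h2) (by decide +kernel))
      (isIndContained_of_hasCode H G9_adj_iff)
  have h8 : ¬ HasCode G 6 25399 := fun H => hx.g8 <|
    nonempty_iso_of_coversExt (c := certG8) hG (by norm_num) G8_adj_iff (by norm_num)
      (by decide +kernel)
      (h.not_hasCode_of_cert [(7, 713527), (7, 1598263)] (by simpa using ⟨h2, h1⟩)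
        (by decide +kernel))
      (isIndContained_of_hasCode H G8_adj_iff)
  exact ⟨h8, h9⟩

/-! ### Odd triangles with a common edge -/

/-- Some vertex is adjacent to an odd number of the vertices `a`, `b`, `c`. -/
def IsOdd (G : SimpleGraph V) (a b c : V) : Prop :=
  ∃ v, G.Adj a v ↔ (G.Adj b v ↔ G.Adj c v)

/-- Whenever two triangles share an edge and their other vertices are not adjacent, one of the
triangles is even. -/
def NoOddDiamond (G : SimpleGraph V) : Prop :=
  ∀ a b c d, G.Adj a b → G.Adj a c → G.Adj b c → G.Adj b d → G.Adj c d → a ≠ d → ¬ G.Adj a d →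
    IsOdd G a b c → ¬ IsOdd G b c d

/-- The code 55 is the diamond with nonadjacent vertices 0 and 3. The first two disjuncts discard
the masks of the wrong parity. -/
theorem certOneOdd_covers : ((List.range 16).all fun m =>
    (m.testBit 0 == (m.testBit 1 == m.testBit 2)).not ||
    ((m.testBit 1 == (m.testBit 2 == m.testBit 3)).not ||
    certOneOdd.covers 5 (extCode 4 55 m))) = true := by
  decide +kernel

/-- Bit 4 of `l`, the adjacency of the two odd vertices, is unrestricted. -/
theorem certTwoOdd_covers : ((List.range 16).all fun m => (List.range 32).all fun l =>
    (m.testBit 0 == (m.testBit 1 == m.testBit 2)).not ||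
    ((l.testBit 1 == (l.testBit 2 == l.testBit 3)).not ||
    certTwoOdd.covers 6 (extCode 5 (extCode 4 55 m) l))) = true := by
  decide +kernel

/-- A nested biconditional of three statements holds exactly when an odd number of them hold. This
carries that parity over to mask bits. -/
theorem beq_beq_of_iff {A B C : Prop} {p q r : Bool} (h : A ↔ (B ↔ C)) (hA : A ↔ p = true)
    (hB : B ↔ q = true) (hC : C ↔ r = true) : (p == (q == r)) = true := by
  rw [hA, hB, hC] at h
  clear hA hB hC
  revert p q r
  decide

/-- The diamond and the witnesses of oddness span five or six vertices, according to whether the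
witnesses coincide. In every case one of `G1`, …, `G9` is induced there. -/
theorem BeinekeFree.noOddDiamond (h : BeinekeFree G) (hG : G.Connected)
    (hx : NotExceptional G) : NoOddDiamond G := by
  rintro a b c d hab hac hbc hbd hcd hne had ⟨x, hx1⟩ ⟨y, hy1⟩
  obtain ⟨h8, h9⟩ := h.not_hasCode_G8_G9 hG hx
  have hlist : ∀ p ∈ [(6, 25399), (6, 20079)], ¬ HasCode G p.1 p.2 := by simpa using ⟨h8, h9⟩
  set φ : ℕ → V := fun i => if i = 0 then a else if i = 1 then b else if i = 2 then c else d
  have hcode : IsCode G 4 55 φ := by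
    intro i j hij hj
    have hj' : j = 1 ∨ j = 2 ∨ j = 3 := by omega
    rcases hj' with rfl | rfl | rfl <;> interval_cases i <;>
      simp [φ, hab, hac, hbc, hbd, hcd, hne, had, hab.ne, hac.ne, hbc.ne, hbd.ne, hcd.ne] <;>
      decide
  -- A vertex of a triangle has two neighbours in it, and the fourth vertex of the diamond also has
  -- two, so an odd witness lies outside.
  have hodd1 : ∀ i < 4, φ i ≠ x := by
    rintro i hi rfl
    interval_cases i <;>
      simp [φ, hab, hac, hbc, hbd, hcd, had, hab.symm, hac.symm, hbc.symm] at hx1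
  have hodd2 : ∀ i < 4, φ i ≠ y := by
    rintro i hi rfl
    interval_cases i <;>
      simp [φ, hbc, hbd, hcd, G.adj_comm d, had, hab.symm, hac.symm, hbc.symm] at hy1
  obtain ⟨m, hm, hbit⟩ := exists_mask 4 fun i => G.Adj (φ i) x
  have hc1 := hcode.extend (by norm_num) hodd1 hbit
  have hp1 : (m.testBit 0 == (m.testBit 1 == m.testBit 2)) = true :=
    beq_beq_of_iff hx1 (hbit 0 (by norm_num)) (hbit 1 (by norm_num))
        (hbit 2 (by norm_num))
  by_cases hxy : x = y
  · subst hxy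
    have hp2 : (m.testBit 1 == (m.testBit 2 == m.testBit 3)) = true :=
      beq_beq_of_iff hy1 (hbit 1 (by norm_num)) (hbit 2 (by norm_num))
        (hbit 3 (by norm_num))
    have H := List.all_eq_true.1 certOneOdd_covers m (List.mem_range.2 hm)
    rw [hp1, hp2] at H
    obtain ⟨p, hp, hp'⟩ := hc1.exists_of_covers (by simpa using H)
    exact h.not_hasCode_of_cert _ hlist (by decide +kernel) p hp hp'
  · obtain ⟨l, hl, hbit'⟩ := exists_mask 5 fun i => G.Adj (Function.update φ 4 x i) y
    have hc2 := hc1.extend (v := y)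
      (by rw [extCode]; omega)
      (by
        intro i hi
        rcases (Nat.lt_succ_iff.1 hi).lt_or_eq with hi' | rfl
        · rw [Function.update_of_ne hi'.ne]; exact hodd2 i hi'
        · rwa [Function.update_self]) hbit'
    have hp2 : (l.testBit 1 == (l.testBit 2 == l.testBit 3)) = true :=
      beq_beq_of_iff hy1 (hbit' 1 (by norm_num)) (hbit' 2 (by norm_num))
        (hbit' 3 (by norm_num))
    have H := List.all_eq_true.1 (List.all_eq_true.1 certTwoOdd_covers m (List.mem_range.2 hm)) l
      (List.mem_range.2 hl)
    rw [hp1, hp2] at H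
    obtain ⟨p, hp, hp'⟩ := hc2.exists_of_covers (by simpa using H)
    exact h.not_hasCode_of_cert _ hlist (by decide +kernel) p hp hp'

/-! ### Line representations and claw-freeness -/

/-- `f` represents `G` as an induced subgraph of the line graph of the complete graph on `W`. -/
structure IsLineRep {V W : Type*} (G : SimpleGraph V) (f : V → Sym2 W) : Prop where
  not_isDiag : ∀ v, ¬ (f v).IsDiag
  ne : ∀ u v, u ≠ v → f u ≠ f v
  adj_iff : ∀ u v, u ≠ v → (G.Adj u v ↔ ∃ w, w ∈ f u ∧ w ∈ f v)

/-- Among three neighbours of a vertex, two are adjacent. -/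
def ClawFree (G : SimpleGraph V) : Prop :=
  ∀ x a b c, G.Adj x a → G.Adj x b → G.Adj x c → a ≠ b → a ≠ c → b ≠ c →
    G.Adj a b ∨ G.Adj a c ∨ G.Adj b c

theorem clawFree_of_not_isIndContained (h : ¬ G1 ⊴ G) : ClawFree G := by
  intro x a b c hxa hxb hxc hab hac hbc
  by_contra! H
  obtain ⟨h1, h2, h3⟩ := H
  refine h (G1_isIndContained
    ⟨fun i => if i = 0 then x else if i = 1 then a else if i = 2 then b else c, ?_⟩)
  intro i j hij hj
  have hj' : j = 1 ∨ j = 2 ∨ j = 3 := by omega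
  rcases hj' with rfl | rfl | rfl <;> interval_cases i <;>
    simp [hxa, hxb, hxc, hab, hac, hbc, hxa.ne, hxb.ne, hxc.ne, h1, h2, h3] <;> decide

theorem IsOdd.swap {a b c : V} (h : IsOdd G a b c) : IsOdd G b a c := by
  obtain ⟨v, hv⟩ := h
  exact ⟨v, by tauto⟩

theorem IsOdd.rotate {a b c : V} (h : IsOdd G a b c) : IsOdd G b c a := by
  obtain ⟨v, hv⟩ := h
  exact ⟨v, by tauto⟩

theorem IsOdd.of_adj {a b c v : V} (ha : G.Adj a v) (hb : G.Adj b v) (hc : G.Adj c v) :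
    IsOdd G a b c :=
  ⟨v, by tauto⟩

/-! ### Graphs in which two even triangles share an edge -/

/-- Two even triangles `a b c` and `b c d` with the common edge `b c`. -/
structure IsEvenDiamond (G : SimpleGraph V) (a b c d : V) : Prop where
  ab : G.Adj a b
  ac : G.Adj a c
  bc : G.Adj b c
  bd : G.Adj b d
  cd : G.Adj c d
  ne : a ≠ d
  even_left : ¬ IsOdd G a b c
  even_right : ¬ IsOdd G b c d

/-- The vertex `v ≠ c` is adjacent to `a`, `b`, `d` and not to `c`. -/
structure IsSide (G : SimpleGraph V) (a b c d v : V) : Prop where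
  adj_a : G.Adj a v
  adj_b : G.Adj b v
  adj_d : G.Adj d v
  not_adj_c : ¬ G.Adj c v
  ne : c ≠ v

namespace IsEvenDiamond

variable {a b c d v w : V}

theorem swap (h : IsEvenDiamond G a b c d) : IsEvenDiamond G a c b d :=
  ⟨h.ac, h.ab, h.bc.symm, h.cd, h.bd, h.ne, fun ho => h.even_left ho.rotate.rotate.swap,
    fun ho => h.even_right ho.swap⟩

theorem not_adj (h : IsEvenDiamond G a b c d) : ¬ G.Adj a d :=
  fun had => h.even_left (.of_adj had h.bd h.cd)

/-- Evenness of both triangles forces `v` to treat `a` and `d` alike. If it sees both, it sees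
exactly one of `b`, `c`. If neither, it sees both or none of `b`, `c`, and seeing both gives a claw
at `b`. -/
theorem isSide_or (h : IsEvenDiamond G a b c d) (hclaw : ClawFree G) (ha : v ≠ a) (hb : v ≠ b)
    (hc : v ≠ c) (hd : v ≠ d) : IsSide G a b c d v ∨ IsSide G a c b d v ∨
      (¬ G.Adj a v ∧ ¬ G.Adj b v ∧ ¬ G.Adj c v ∧ ¬ G.Adj d v) := by
  have h1 : ¬ (G.Adj a v ↔ (G.Adj b v ↔ G.Adj c v)) := fun ho => h.even_left ⟨v, ho⟩
  have h2 : ¬ (G.Adj b v ↔ (G.Adj c v ↔ G.Adj d v)) := fun ho => h.even_right ⟨v, ho⟩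
  have h3 := fun hv => hclaw b a d v h.ab.symm h.bd hv h.ne ha.symm hd.symm
  have h4 := h.not_adj
  by_cases va : G.Adj a v <;> by_cases vb : G.Adj b v <;> by_cases vc : G.Adj c v <;>
    by_cases vd : G.Adj d v <;>
    simp only [va, vb, vc, vd, h4, or_self, imp_false, not_true, iff_true, iff_self, iff_false,
      not_false_eq_true, forall_true_left] at h1 h2 h3
  · exact Or.inl ⟨va, vb, vd, vc, hc.symm⟩
  · exact Or.inr (Or.inl ⟨va, vc, vd, vb, hb.symm⟩)
  · exact Or.inr (Or.inr ⟨va, vb, vc, vd⟩)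

/-- Two such vertices are adjacent, by the claw condition at `b`. Then `w` sees all of `a b v` and
of `b v d`, which form a forbidden odd diamond. -/
theorem isSide_unique (h : IsEvenDiamond G a b c d) (hclaw : ClawFree G) (hno : NoOddDiamond G)
    (hv : IsSide G a b c d v) (hw : IsSide G a b c d w) : v = w := by
  by_contra hvw
  rcases hclaw b c v w h.bc hv.adj_b hw.adj_b hv.ne hw.ne hvw with hadj | hadj | hadj
  · exact hv.not_adj_c hadj
  · exact hw.not_adj_c hadj
  · exact hno a b v d h.ab hv.adj_a hv.adj_b h.bd hv.adj_d.symm h.ne h.not_adj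
      (.of_adj hw.adj_a hw.adj_b hadj) (.of_adj hw.adj_b hadj hw.adj_d)

/-- Otherwise `w` sees only `a` in `a b v` and only `d` in `b v d`, making both triangles odd. -/
theorem adj_of_isSide (h : IsEvenDiamond G a b c d) (hno : NoOddDiamond G)
    (hv : IsSide G a b c d v) (hw : IsSide G a c b d w) : G.Adj v w := by
  by_contra hvw
  refine hno a b v d h.ab hv.adj_a hv.adj_b h.bd hv.adj_d.symm h.ne h.not_adj ⟨w, ?_⟩ ⟨w, ?_⟩ <;>
    simp [hw.adj_a, hw.not_adj_c, hw.adj_d, hvw]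

/-- A vertex that sees none of `a`, `b`, `c`, `d` cannot be attached to a side vertex `s`: it would
form a claw at `s` with `a` and `d`. Connectedness then leaves no further vertices. -/
theorem cases_vertex (h : IsEvenDiamond G a b c d) (hG : G.Connected) (hclaw : ClawFree G)
    (v : V) : v = a ∨ v = b ∨ v = c ∨ v = d ∨ IsSide G a b c d v ∨ IsSide G a c b d v := by
  by_contra hv
  obtain ⟨p⟩ := hG.preconnected a v
  obtain ⟨e, -, hs, hu⟩ := p.exists_boundary_dart {v | v = a ∨ v = b ∨ v = c ∨ v = d ∨
    IsSide G a b c d v ∨ IsSide G a c b d v} (Or.inl rfl) hv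
  have hadj := e.adj
  generalize e.fst = s at *
  generalize e.snd = u at *
  simp only [Set.mem_ofPred_eq, not_or] at hs hu
  obtain ⟨ua, ub, uc, ud, u1, u2⟩ := hu
  obtain ⟨na, nb, nc, nd⟩ := ((h.isSide_or hclaw ua ub uc ud).resolve_left u1).resolve_left u2
  have key : G.Adj a s → G.Adj d s → False := fun has hds => by
    rcases hclaw s a d u has.symm hds.symm hadj h.ne (Ne.symm ua) (Ne.symm ud) with H | H | H
    exacts [h.not_adj H, na H, nd H]
  rcases hs with rfl | rfl | rfl | rfl | hs | hs
  exacts [na hadj, nb hadj, nc hadj, nd hadj, key hs.adj_a hs.adj_d, key hs.adj_a hs.adj_d]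

open Classical in
/-- The edge of `K_4` that represents the vertex `x`. -/
noncomputable def edge (G : SimpleGraph V) (a b c d x : V) : Sym2 (Fin 4) :=
  if x = a then s(0, 1) else if x = d then s(2, 3) else if x = b then s(0, 3) else
    if x = c then s(0, 2) else if G.Adj b x then s(1, 3) else s(1, 2)

theorem edge_cases (h : IsEvenDiamond G a b c d) (hG : G.Connected) (hclaw : ClawFree G) (x : V) :
    (x = a ∧ edge G a b c d x = s(0, 1)) ∨ (x = d ∧ edge G a b c d x = s(2, 3)) ∨
    (x = b ∧ edge G a b c d x = s(0, 3)) ∨ (x = c ∧ edge G a b c d x = s(0, 2)) ∨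
    (IsSide G a b c d x ∧ edge G a b c d x = s(1, 3)) ∨
    (IsSide G a c b d x ∧ edge G a b c d x = s(1, 2)) := by
  rcases h.cases_vertex hG hclaw x with rfl | rfl | rfl | rfl | hx | hx
  · exact Or.inl ⟨rfl, by simp [edge]⟩
  · exact Or.inr (Or.inr (Or.inl ⟨rfl, by simp [edge, h.ab.ne', h.bd.ne]⟩))
  · exact Or.inr (Or.inr (Or.inr (Or.inl ⟨rfl, by simp [edge, h.ac.ne', h.cd.ne, h.bc.ne']⟩)))
  · exact Or.inr (Or.inl ⟨rfl, by simp [edge, h.ne.symm]⟩)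
  · exact Or.inr (Or.inr (Or.inr (Or.inr (Or.inl
      ⟨hx, by simp [edge, hx.adj_a.ne', hx.adj_b.ne', hx.adj_d.ne', hx.ne.symm, hx.adj_b]⟩))))
  · exact Or.inr (Or.inr (Or.inr (Or.inr (Or.inr
      ⟨hx, by simp [edge, hx.adj_a.ne', hx.adj_b.ne', hx.adj_d.ne', hx.ne.symm, hx.not_adj_c]⟩))))

/-- The at most six vertices lie in the octahedron `L(K_4)`. Its nonadjacent pairs are `a` and `d`,
and `b` and `c` each with the side vertex that misses it. They go to pairs of disjoint edges. -/
theorem isLineRep (h : IsEvenDiamond G a b c d) (hG : G.Connected) (hclaw : ClawFree G)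
    (hno : NoOddDiamond G) : IsLineRep G (edge G a b c d) := by
  have had := h.not_adj
  have hcat := h.edge_cases hG hclaw
  have main : ∀ u v, u ≠ v → edge G a b c d u ≠ edge G a b c d v ∧
      (G.Adj u v ↔ ∃ w, w ∈ edge G a b c d u ∧ w ∈ edge G a b c d v) := by
    intro u v huv
    rcases hcat u with ⟨hu, fu⟩ | ⟨hu, fu⟩ | ⟨hu, fu⟩ | ⟨hu, fu⟩ | ⟨hu, fu⟩ | ⟨hu, fu⟩ <;>
    rcases hcat v with ⟨hv, fv⟩ | ⟨hv, fv⟩ | ⟨hv, fv⟩ | ⟨hv, fv⟩ | ⟨hv, fv⟩ | ⟨hv, fv⟩ <;>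
    rw [fu, fv] <;>
    clear fu fv hcat <;>
    first
    | exact absurd (hu.trans hv.symm) huv
    | exact absurd (h.isSide_unique hclaw hno hu hv) huv
    | exact absurd (h.swap.isSide_unique hclaw hno hu hv) huv
    | refine ⟨by decide, iff_of_true ?_ (by decide)⟩
      first
      | exact h.adj_of_isSide hno hu hv
      | exact (h.adj_of_isSide hno hv hu).symm
      | (rw [hu, hv]; first
          | exact h.ab | exact h.ac | exact h.bc | exact h.bd | exact h.cd
          | exact h.ab.symm | exact h.ac.symm | exact h.bc.symm | exact h.bd.symm
          | exact h.cd.symm)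
      | (rw [hu]; first | exact hv.adj_a | exact hv.adj_b | exact hv.adj_d)
      | (rw [hv]; first | exact hu.adj_a.symm | exact hu.adj_b.symm | exact hu.adj_d.symm)
    | refine ⟨by decide, iff_of_false ?_ (by decide)⟩
      first
      | (rw [hu, hv]; first | exact had | exact fun H => had H.symm)
      | (rw [hu]; exact hv.not_adj_c)
      | (rw [hv]; exact fun H => hu.not_adj_c H.symm)
  refine ⟨fun v => ?_, fun u v h => (main u v h).1, fun u v h => (main u v h).2⟩
  rcases hcat v with ⟨-, h⟩ | ⟨-, h⟩ | ⟨-, h⟩ | ⟨-, h⟩ | ⟨-, h⟩ | ⟨-, h⟩ <;> rw [h] <;> decide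

end IsEvenDiamond

/-! ### Graphs in which no two even triangles share an edge -/

/-- The clique of the vertices that form an odd triangle with the edge `x y`, with `x` and `y`. -/
def oddClique (G : SimpleGraph V) (x y : V) : Set V :=
  {z | z = x ∨ z = y ∨ (G.Adj x z ∧ G.Adj y z ∧ IsOdd G x y z)}

theorem left_mem_oddClique (x y : V) : x ∈ oddClique G x y := Or.inl rfl

theorem right_mem_oddClique (x y : V) : y ∈ oddClique G x y := Or.inr (Or.inl rfl)

theorem oddClique_comm (x y : V) : oddClique G x y = oddClique G y x := by
  ext z
  have : IsOdd G x y z ↔ IsOdd G y x z := ⟨IsOdd.swap, IsOdd.swap⟩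
  simp only [oddClique, Set.mem_ofPred_eq, this]
  tauto

theorem adj_of_mem_oddClique_left {x y z : V} (hxy : G.Adj x y) (hz : z ∈ oddClique G x y)
    (hzx : z ≠ x) : G.Adj x z := by
  rcases hz with rfl | rfl | hz
  · exact absurd rfl hzx
  · exact hxy
  · exact hz.1

/-- If `w` missed `y`, the odd triangles `y x z` and `x z w` would form a forbidden diamond. Hence
`x y w` is a triangle, and it is odd because `z` sees all of it. -/
theorem NoOddDiamond.oddClique_subset (h : NoOddDiamond G) {x y z : V} (hxy : G.Adj x y)
    (hxz : G.Adj x z) (hyz : G.Adj y z) (hodd : IsOdd G x y z) :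
    oddClique G x z ⊆ oddClique G x y := by
  rintro w (rfl | rfl | ⟨hxw, hzw, hw⟩)
  · exact Or.inl rfl
  · exact Or.inr (Or.inr ⟨hxz, hyz, hodd⟩)
  · by_cases hyw : w = y
    · exact Or.inr (Or.inl hyw)
    have hadj : G.Adj y w := by
      by_contra hn
      exact h y x z w hxy.symm hyz hxz hxw hzw (Ne.symm hyw) hn hodd.swap hw
    exact Or.inr (Or.inr ⟨hxw, hadj, .of_adj hxz hyz hzw.symm⟩)

theorem NoOddDiamond.oddClique_eq_left (h : NoOddDiamond G) {x y z : V} (hxy : G.Adj x y)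
    (hz : z ∈ oddClique G x y) (hzx : z ≠ x) : oddClique G x z = oddClique G x y := by
  rcases hz with rfl | rfl | ⟨hxz, hyz, hodd⟩
  · exact absurd rfl hzx
  · rfl
  · exact (h.oddClique_subset hxy hxz hyz hodd).antisymm
      (h.oddClique_subset hxz hxy hyz.symm hodd.swap.rotate)

/-- At most two cliques pass through `x`. Given three, adjacent `y` and `z` would form an even
triangle with `x`, so `w` would see exactly one of them. The triangle of `w`, `x` and that one is
odd by `heven`, so two of the cliques coincide. Hence `y`, `z`, `w` are pairwise nonadjacent: a claw
at `x`. -/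
theorem NoOddDiamond.adj_or_eq (h : NoOddDiamond G) (hclaw : ClawFree G)
    (heven : ∀ a b c d, G.Adj a b → G.Adj a c → G.Adj b c → G.Adj b d → G.Adj c d → a ≠ d →
      ¬ IsOdd G a b c → IsOdd G b c d) {x y z w : V} (hxy : G.Adj x y) (hxz : G.Adj x z)
    (hxw : G.Adj x w) : oddClique G x y = oddClique G x z ∨ oddClique G x y = oddClique G x w ∨
      oddClique G x z = oddClique G x w := by
  have key : ∀ y z w, G.Adj x y → G.Adj x z → G.Adj x w → oddClique G x y ≠ oddClique G x z →
      oddClique G x y ≠ oddClique G x w → oddClique G x z ≠ oddClique G x w →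
      ¬ G.Adj y z := by
    intro y z w hxy hxz hxw hyz hyw hzw hadj
    have hnot : ¬ IsOdd G x y z := fun ho =>
      hyz (h.oddClique_eq_left hxy (Or.inr (Or.inr ⟨hxz, hadj, ho⟩)) hxz.ne').symm
    have hw : ¬ (G.Adj x w ↔ (G.Adj y w ↔ G.Adj z w)) := fun ho => hnot ⟨w, ho⟩
    by_cases hyw' : G.Adj y w
    · have ho := heven z x y w hxz.symm hadj.symm hxy hxw hyw'
        (fun e => hzw (by rw [e])) fun ho => hnot ho.rotate
      exact hyw (h.oddClique_eq_left hxy (Or.inr (Or.inr ⟨hxw, hyw', ho⟩)) hxw.ne').symm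
    · have hzw' : G.Adj z w := by tauto
      have ho := heven y x z w hxy.symm hadj hxz hxw hzw'
        (fun e => hyw (by rw [e])) fun ho => hnot ho.swap
      exact hzw (h.oddClique_eq_left hxz (Or.inr (Or.inr ⟨hxw, hzw', ho⟩)) hxw.ne').symm
  by_contra! H
  obtain ⟨h1, h2, h3⟩ := H
  rcases hclaw x y z w hxy hxz hxw (fun e => h1 (by rw [e])) (fun e => h2 (by rw [e]))
    (fun e => h3 (by rw [e])) with hadj | hadj | hadj
  · exact key y z w hxy hxz hxw h1 h2 h3 hadj
  · exact key y w z hxy hxw hxz h2 h1 h3.symm hadj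
  · exact key z w y hxz hxw hxy h3 h1.symm h2.symm hadj

theorem NoOddDiamond.exists_isLineRep_of_no_even (h : NoOddDiamond G) (hclaw : ClawFree G)
    (heven : ∀ a b c d, G.Adj a b → G.Adj a c → G.Adj b c → G.Adj b d → G.Adj c d → a ≠ d →
      ¬ IsOdd G a b c → IsOdd G b c d) (hnb : ∀ x, ∃ y, G.Adj x y) :
    ∃ f : V → Sym2 (Set V), IsLineRep G f := by
  -- Each vertex becomes the pair of its cliques. If all its edges lie in one clique, the singleton
  -- `{x}` is the other end, a leaf of the root that no other vertex uses.
  have hsides : ∀ x, ∃ A B : Set V, A ≠ B ∧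
      (A = {x} ∨ ∃ y, G.Adj x y ∧ A = oddClique G x y) ∧
      (B = {x} ∨ ∃ y, G.Adj x y ∧ B = oddClique G x y) ∧
      ∀ y, G.Adj x y → oddClique G x y = A ∨ oddClique G x y = B := by
    intro x
    obtain ⟨y, hxy⟩ := hnb x
    by_cases hz : ∃ z, G.Adj x z ∧ oddClique G x y ≠ oddClique G x z
    · obtain ⟨z, hxz, hne⟩ := hz
      refine ⟨_, _, hne, Or.inr ⟨y, hxy, rfl⟩, Or.inr ⟨z, hxz, rfl⟩, fun w hxw => ?_⟩
      rcases h.adj_or_eq hclaw heven hxy hxz hxw with H | H | H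
      · exact absurd H hne
      · exact Or.inl H.symm
      · exact Or.inr H.symm
    · push Not at hz
      refine ⟨oddClique G x y, {x}, fun e => ?_, Or.inr ⟨y, hxy, rfl⟩, Or.inl rfl,
        fun w hxw => Or.inl (hz w hxw).symm⟩
      have := right_mem_oddClique (G := G) x y
      rw [e] at this
      exact hxy.ne' this
  choose A B hAB hA hB hcov using hsides
  have hmem : ∀ x C, C ∈ s(A x, B x) → C = {x} ∨ ∃ y, G.Adj x y ∧ C = oddClique G x y := by
    intro x C hC
    rcases Sym2.mem_iff.1 hC with rfl | rfl
    exacts [hA x, hB x]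
  have hself : ∀ x C, C ∈ s(A x, B x) → x ∈ C := by
    intro x C hC
    rcases hmem x C hC with rfl | ⟨y, -, rfl⟩
    exacts [rfl, left_mem_oddClique x y]
  have hshare : ∀ u v C, u ≠ v → C ∈ s(A u, B u) → C ∈ s(A v, B v) →
      G.Adj u v ∧ C = oddClique G u v := by
    intro u v C huv hu hv
    have hvC := hself v C hv
    rcases hmem u C hu with rfl | ⟨y, huy, rfl⟩
    · exact absurd hvC.symm huv
    · exact ⟨adj_of_mem_oddClique_left huy hvC huv.symm,
        (h.oddClique_eq_left huy hvC huv.symm).symm⟩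
  refine ⟨fun x => s(A x, B x), fun x => by simpa using hAB x, fun u v huv e => ?_,
    fun u v huv => ⟨fun hadj => ?_, fun ⟨C, hu, hv⟩ => (hshare u v C huv hu hv).1⟩⟩
  · have h1 := hshare u v (A u) huv (Sym2.mem_mk_left _ _) (e ▸ Sym2.mem_mk_left _ _)
    have h2 := hshare u v (B u) huv (Sym2.mem_mk_right _ _) (e ▸ Sym2.mem_mk_right _ _)
    exact hAB u (h1.2.trans h2.2.symm)
  · refine ⟨oddClique G u v, Sym2.mem_iff.2 (hcov u v hadj), Sym2.mem_iff.2 ?_⟩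
    rw [oddClique_comm]
    exact hcov v u hadj.symm

/-! ### From a line representation to a connected root -/

/-- A connected graph with a line representation is the line graph of a connected graph. -/
theorem IsLineRep.exists_connected [Finite V] {W : Type*} {f : V → Sym2 W} (h : IsLineRep G f)
    (hG : G.Connected) :
    ∃ (m : ℕ) (H : SimpleGraph (Fin m)), H.Connected ∧ Nonempty (G ≃g H.lineGraph) := by
  classical
  have hex : ∀ v, ∃ p q : W, f v = s(p, q) := fun v => by
    induction f v with | _ p q => exact ⟨p, q, rfl⟩
  choose p q hf using hex
  have hpq : ∀ v, p v ≠ q v := fun v e => h.not_isDiag v (by rw [hf, e]; simp)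
  -- Only labels that occur are kept, since an unused label would be an isolated vertex of the root.
  let U := Set.range (Sum.elim p q)
  let p' : V → U := fun v => ⟨p v, Sum.inl v, rfl⟩
  let q' : V → U := fun v => ⟨q v, Sum.inr v, rfl⟩
  have hpq' : ∀ v, p' v ≠ q' v := fun v e => hpq v (congrArg Subtype.val e)
  let H : SimpleGraph U := SimpleGraph.fromEdgeSet (Set.range fun v => s(p' v, q' v))
  have hmap : ∀ v, (s(p' v, q' v)).map Subtype.val = f v := fun v => (hf v).symm
  have hedge : ∀ v, s(p' v, q' v) ∈ H.edgeSet := fun v => by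
    rw [SimpleGraph.mem_edgeSet]
    exact ⟨⟨v, rfl⟩, hpq' v⟩
  let F : V → H.edgeSet := fun v => ⟨s(p' v, q' v), hedge v⟩
  have hF : Function.Bijective F := by
    constructor
    · intro u v e
      by_contra huv
      have e' : s(p' u, q' u) = s(p' v, q' v) := congrArg Subtype.val e
      exact h.ne u v huv (by rw [← hmap u, ← hmap v, e'])
    · rintro ⟨e, he⟩
      induction e with | _ x y =>
      rw [SimpleGraph.mem_edgeSet, SimpleGraph.fromEdgeSet_adj] at he
      obtain ⟨⟨v, hv⟩, -⟩ := he
      exact ⟨v, Subtype.ext hv⟩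
  have hmem : ∀ v (x : U), x ∈ s(p' v, q' v) ↔ x.1 ∈ f v := fun v x => by
    rw [hf, Sym2.mem_iff, Sym2.mem_iff, Subtype.ext_iff, Subtype.ext_iff]
  let iso : G ≃g H.lineGraph :=
    { toEquiv := Equiv.ofBijective F hF
      map_rel_iff' := by
        intro u v
        change H.lineGraph.Adj (F u) (F v) ↔ _
        rw [SimpleGraph.lineGraph_adj_iff_exists, hF.1.ne_iff]
        by_cases huv : u = v
        · simp [huv]
        rw [h.adj_iff u v huv]
        simp only [ne_eq, huv, not_false_eq_true, true_and]
        constructor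
        · rintro ⟨x, hx, hy⟩
          exact ⟨x, (hmem u x).1 hx, (hmem v x).1 hy⟩
        · rintro ⟨w, hw, hw'⟩
          have hU : w ∈ U := by
            rw [hf, Sym2.mem_iff] at hw
            rcases hw with rfl | rfl
            exacts [⟨Sum.inl u, rfl⟩, ⟨Sum.inr u, rfl⟩]
          exact ⟨⟨w, hU⟩, (hmem u ⟨w, hU⟩).2 hw, (hmem v ⟨w, hU⟩).2 hw'⟩ }
  have hstep : ∀ v (x y : U), x ∈ s(p' v, q' v) → y ∈ s(p' v, q' v) → H.Reachable x y := by
    intro v x y hx hy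
    have hadj : H.Adj (p' v) (q' v) := hedge v
    rw [Sym2.mem_iff] at hx hy
    rcases hx with rfl | rfl <;> rcases hy with rfl | rfl
    exacts [.refl _, hadj.reachable, hadj.symm.reachable, .refl _]
  have hwalk : ∀ u v, G.Reachable u v → H.Reachable (p' u) (p' v) := by
    rintro u v ⟨w⟩
    induction w with
    | nil => exact .refl _
    | @cons u v _ hadj _ ih =>
      obtain ⟨w, hu, hv⟩ := (h.adj_iff u v hadj.ne).1 hadj
      have hU : w ∈ U := by
        rw [hf, Sym2.mem_iff] at hu
        rcases hu with rfl | rfl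
        exacts [⟨Sum.inl u, rfl⟩, ⟨Sum.inr u, rfl⟩]
      exact ((hstep u _ ⟨w, hU⟩ (Sym2.mem_mk_left _ _) ((hmem u ⟨w, hU⟩).2 hu)).trans
        (hstep v ⟨w, hU⟩ _ ((hmem v ⟨w, hU⟩).2 hv) (Sym2.mem_mk_left _ _))).trans ih
  have hin : ∀ x : U, ∃ v, x ∈ s(p' v, q' v) := by
    rintro ⟨x, v | v, rfl⟩
    exacts [⟨v, Sym2.mem_mk_left _ _⟩, ⟨v, Sym2.mem_mk_right _ _⟩]
  obtain ⟨v₀⟩ := hG.nonempty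
  have hH : H.Connected := by
    refine (SimpleGraph.connected_iff _).2 ⟨fun x y => ?_, ⟨p' v₀⟩⟩
    obtain ⟨u, hu⟩ := hin x
    obtain ⟨v, hv⟩ := hin y
    exact ((hstep u x _ hu (Sym2.mem_mk_left _ _)).trans (hwalk u v (hG.preconnected u v))).trans
      (hstep v _ y (Sym2.mem_mk_left _ _) hv)
  have : Fintype U := Fintype.ofFinite U
  let e := H.overFinIso (n := Fintype.card U) rfl
  exact ⟨_, H.overFin rfl, e.connected_iff.1 hH, ⟨iso.trans e.lineGraph⟩⟩

/-- **Šoltés.** A connected graph without `G1`, …, `G7` and not one of the five exceptions is the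
line graph of a connected graph. -/
theorem exists_lineGraph_iso [Finite V] (hG : G.Connected) (h : BeinekeFree G)
    (hx : NotExceptional G) :
    ∃ (m : ℕ) (H : SimpleGraph (Fin m)), H.Connected ∧ Nonempty (G ≃g H.lineGraph) := by
  have hclaw := clawFree_of_not_isIndContained h.g1
  have hno := h.noOddDiamond hG hx
  by_cases hnb : ∀ x, ∃ y, G.Adj x y
  · by_cases heven : ∃ a b c d, IsEvenDiamond G a b c d
    · obtain ⟨a, b, c, d, hd⟩ := heven
      exact (hd.isLineRep hG hclaw hno).exists_connected hG
    · obtain ⟨f, hf⟩ := hno.exists_isLineRep_of_no_even hclaw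
        (fun a b c d ab ac bc bd cd ne ho => by
          by_contra ho'
          exact heven ⟨a, b, c, d, ab, ac, bc, bd, cd, ne, ho, ho'⟩) hnb
      exact hf.exists_connected hG
  · push Not at hnb
    obtain ⟨x, hx⟩ := hnb
    have hsub : Subsingleton V := by
      by_contra hns
      rw [not_subsingleton_iff_nontrivial] at hns
      obtain ⟨y, hy⟩ := hG.preconnected.exists_adj_of_nontrivial x
      exact hx y hy
    -- A connected graph with an isolated vertex is a single vertex, the line graph of `K_2`.
    have hrep : IsLineRep G fun _ => s((0 : Fin 2), 1) :=
      ⟨fun _ => by simp, fun u v huv => absurd (Subsingleton.elim u v) huv,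
        fun u v huv => absurd (Subsingleton.elim u v) huv⟩
    exact hrep.exists_connected hG

/-! ### Descending through the roots -/

/-- If `K` is the line graph of `H`, then `L^n(K)` is `L^{n+1}(H)`. -/
theorem nonempty_iso_iterLine_succ {W : Type*} {W' : Type*} {K : SimpleGraph W}
    {H : SimpleGraph W'} (e : K ≃g H.lineGraph) (n : ℕ) :
    Nonempty (iterLine K n ≃g iterLine H (n + 1)) := by
  induction n with
  | zero => exact ⟨e⟩
  | succ n ih =>
    obtain ⟨f⟩ := ih
    exact ⟨f.lineGraph⟩

/-- No subgraph of `K` is a copy of `G2` or `G4`. -/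
structure HasNoG2G4 (K : SimpleGraph V) : Prop where
  g2 : ¬ G2 ⊑ K
  g4 : ¬ G4 ⊑ K

theorem isContained_of_map {n m : ℕ} {A : SimpleGraph (Fin n)} {B : SimpleGraph (Fin m)}
    (f : Fin n → Fin m) (hf : ∀ i j, f i = f j → i = j) (h : ∀ i j, A.Adj i j → B.Adj (f i) (f j)) :
    A ⊑ B :=
  ⟨⟨⟨f, fun {i j} => h i j⟩, fun i j => hf i j⟩⟩

theorem HasNoG2G4.beinekeFree {K : SimpleGraph V} (h : HasNoG2G4 K) (h1 : ¬ G1 ⊴ K) :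
    BeinekeFree K where
  g1 := h1
  g2 H := h.g2 H.isContained
  g3 H := h.g2 (.trans (isContained_of_map id (by decide) (by decide)) H.isContained)
  g4 H := h.g4 H.isContained
  g5 H := h.g4 (.trans (isContained_of_map id (by decide) (by decide)) H.isContained)
  g6 H := h.g4 (.trans (isContained_of_map id (by decide) (by decide)) H.isContained)
  g7 H := h.g4 (.trans (isContained_of_map id (by decide) (by decide)) H.isContained)

theorem HasNoG2G4.notExceptional {K : SimpleGraph V} (h : HasNoG2G4 K) :
    NotExceptional K where
  g8 := fun ⟨e⟩ => h.g4 (.trans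
    (isContained_of_map ![1, 2, 3, 4, 0, 5] (by decide) (by decide)) e.isContained')
  g9 := fun ⟨e⟩ => h.g4 (.trans
    (isContained_of_map ![1, 0, 2, 3, 5, 4] (by decide) (by decide)) e.isContained')
  h1 := fun ⟨e⟩ => h.g4 (.trans
    (isContained_of_map ![1, 2, 3, 4, 0, 5] (by decide) (by decide)) e.isContained')
  h2 := fun ⟨e⟩ => h.g4 (.trans
    (isContained_of_map ![1, 2, 3, 4, 0, 5] (by decide) (by decide)) e.isContained')
  h3 := fun ⟨e⟩ => h.g4 (.trans
    (isContained_of_map ![1, 2, 3, 4, 0, 5] (by decide) (by decide)) e.isContained')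

theorem isContained_lineGraph {n m : ℕ} {A : SimpleGraph (Fin n)} {B : SimpleGraph (Fin m)}
    (f : Fin n → Sym2 (Fin m)) (hB : ∀ i, f i ∈ B.edgeSet) (hf : ∀ i j, f i = f j → i = j)
    (h : ∀ i j, A.Adj i j → ∃ v, v ∈ f i ∧ v ∈ f j) : A ⊑ B.lineGraph :=
  ⟨⟨⟨fun i => ⟨f i, hB i⟩, fun {i j} hij => SimpleGraph.lineGraph_adj_iff_exists.2
    ⟨fun e => hij.ne (hf i j (congrArg Subtype.val e)), h i j hij⟩⟩,
    fun i j e => hf i j (congrArg Subtype.val e)⟩⟩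

/-- The listed edges are the images of the vertices of `G4`. The edge `s(1, 2)` shared by the two
triangles goes to one of the two central vertices. -/
theorem G4_isContained_F1 : G4 ⊑ F1 :=
  isContained_lineGraph ![s(0, 2), s(1, 2), s(0, 1), s(1, 3), s(0, 4), s(3, 5)] (by decide)
    (by decide) (by decide)

theorem G4_isContained_F2 : G4 ⊑ F2 :=
  isContained_lineGraph ![s(0, 2), s(1, 2), s(0, 1), s(1, 3), s(0, 4), s(3, 4)] (by decide)
    (by decide) (by decide)

/-- If the line graph of `H` contains no `G4`, then `H` contains neither `G2` nor `G4`. -/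
theorem HasNoG2G4.of_lineGraph {W : Type*} {K : SimpleGraph V} {H : SimpleGraph W}
    (h : HasNoG2G4 K) (e : K ≃g H.lineGraph) : HasNoG2G4 H where
  g2 H2 := h.g4 ((G4_isContained_F2.trans H2.isIndContained_lineGraph.isContained).trans
    e.isContained')
  g4 H4 := h.g4 ((G4_isContained_F1.trans H4.isIndContained_lineGraph.isContained).trans
    e.isContained')

end HigherLine

-- `hK3` is implied by `hclaw`: the claw is a preimage of `K_3`.
open HigherLine in
theorem mainTheorem3 {V : Type*} [Finite V] (G : SimpleGraph V) (hG : G.Connected)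
    (hK3 : ¬ Nonempty (G ≃g (⊤ : SimpleGraph (Fin 3))))
    (hG8 : ¬ Nonempty (G ≃g G8)) (hG9 : ¬ Nonempty (G ≃g G9))
    (hH1 : ¬ Nonempty (G ≃g H1)) (hH2 : ¬ Nonempty (G ≃g H2)) (hH3 : ¬ Nonempty (G ≃g H3))
    (n : ℕ) (hn : 2 ≤ n)
    (hclaw : ∀ i : ℕ, 1 ≤ i → i ≤ n - 1 → ∀ (m : ℕ) (K : SimpleGraph (Fin m)),
      IsPreimage i G K → ¬ G1 ⊴ K)
    (hG1 : ¬ G1 ⊴ G) (hG2 : ¬ G2 ⊴ G) (hG3 : ¬ G3 ⊴ G) (hG4 : ¬ G4 ⊴ G)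
    (hG5 : ¬ G5 ⊴ G) (hG6 : ¬ G6 ⊴ G) (hG7 : ¬ G7 ⊴ G)
    (hF1 : ¬ F1 ⊴ G) (hF2 : ¬ F2 ⊴ G) :
    ∃ (m : ℕ) (H : SimpleGraph (Fin m)), H.Connected ∧ Nonempty (G ≃g iterLine H n) := by
  -- Stage `i` yields the root of order `i + 1`, so the last stage `n - 1` yields order `n`.
  -- Claw-freeness is needed only for roots that are themselves resolved further, those of order at
  -- most `n - 1`.
  have key : ∀ i, i ≤ n - 1 → ∃ (m : ℕ) (H : SimpleGraph (Fin m)), H.Connected ∧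
      Nonempty (G ≃g iterLine H (i + 1)) ∧ HasNoG2G4 H := by
    intro i
    induction i with
    | zero =>
      intro _
      obtain ⟨m, H, hH, ⟨e⟩⟩ := exists_lineGraph_iso hG ⟨hG1, hG2, hG3, hG4, hG5, hG6, hG7⟩
        ⟨hG8, hG9, hH1, hH2, hH3⟩
      exact ⟨m, H, hH, ⟨e⟩, fun h => hF2 (h.isIndContained_lineGraph.trans e.isIndContained'),
        fun h => hF1 (h.isIndContained_lineGraph.trans e.isIndContained')⟩
    | succ i ih =>
      intro hi
      obtain ⟨m, K, hK, ⟨e⟩, hfree⟩ := ih (by omega)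
      obtain ⟨m', H, hH, ⟨e'⟩⟩ := exists_lineGraph_iso hK
        (hfree.beinekeFree (hclaw (i + 1) (by omega) hi m K ⟨hK, ⟨e⟩⟩)) hfree.notExceptional
      obtain ⟨f⟩ := nonempty_iso_iterLine_succ e' (i + 1)
      exact ⟨m', H, hH, ⟨e.trans f⟩, hfree.of_lineGraph e'⟩
  obtain ⟨m, H, hH, he, -⟩ := key (n - 1) le_rfl
  rw [Nat.sub_add_cancel (by omega)] at he
  exact ⟨m, H, hH, he⟩
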